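/- Let $(M,g)$ be a finite-dimensional smooth Riemannian manifold, let $F=(F_1,\dots,F_k):M\to\mathbb R^k$ be smooth, let $c\in\mathbb R^k$ be a regular value of $F$, and let $S=F^{-1}(c)$, regarded as an embedded smooth submanifold of $M$ with the metric $g^S_{ind}$ induced by $g$. Let $G_S:S\to\mathbb R$ be smooth and let $G:M\to\mathbb R$ be any smooth function with $G|_S=G_S$. For a smooth function $f$ on a Riemannian manifold with Levi-Civita connection $\nabla$, let $\mathrm{Hess}\,f(x)(\eta,\xi)=\langle\nabla_\eta\,\mathrm{grad}\,f,\xi\rangle$ for $\eta,\xi$ in the tangent space at $x$. For functions $f_1,\dots,f_r,h_1,\dots,h_s$ on $M$, let $\Sigma^{(f_1,\dots,f_r)}_{(h_1,\dots,h_s)}$ be the $r\times s$ matrix with entry $\langle\mathrm{grad}\,h_j,\mathrm{grad}\,f_i\rangle$ in row $i$ and column $j$. Then for every $x\in S$ (critical for $G_S$ or not): 1. $\Sigma(x):=\det\Sigma^{(F_1,\dots,F_k)}_{(F_1,\dots,F_k)}(x)\neq 0$, so that the numbers $$\sigma_i(x)=\frac{\det\Sigma^{(F_1,\dots,F_k)}_{(F_1,\dots,F_{i-1},G,F_{i+1},\dots,F_k)}(x)}{\Sigma(x)},\qquad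 i=1,\dots,k,$$ are well defined. 2. The Hessian $\mathrm{Hess}\,G_S(x)$ of $G_S$ with respect to $g^S_{ind}$ is a symmetric bilinear form on $T_xS$, and $$\mathrm{Hess}\,G_S(x)=\mathrm{Hess}\,G(x)|_{T_xS\times T_xS}-\sum_{i=1}^k\sigma_i(x)\,\mathrm{Hess}\,F_i(x)|_{T_xS\times T_xS}.$$ 3. If $x$ is a critical point of $G_S$, then the $\sigma_i(x)$ are the Lagrange multipliers of $G$ constrained to $S$ at $x$: $\mathrm{grad}\,G(x)=\sum_{i=1}^k\sigma_i(x)\,\mathrm{grad}\,F_i(x)$, and $(\sigma_1(x),\dots,\sigma_k(x))$ is the only $k$-tuple of real numbers with this property. -/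

import Mathlib

open scoped Manifold ContDiff

noncomputable section

namespace RiemHess

section Manifold

variable {E : Type*} [NormedAddCommGroup E] [NormedSpace ℝ E]
variable {M : Type*} [TopologicalSpace M] [ChartedSpace E M]

/-- A field of (continuous) bilinear forms on the tangent spaces of `M`. Riemannian metrics are
used through their underlying fields of bilinear forms. -/
abbrev FormField (E : Type*) [NormedAddCommGroup E] [NormedSpace ℝ E]
    (M : Type*) [TopologicalSpace M] [ChartedSpace E M] : Type _ :=
  (x : M) → TangentSpace 𝓘(ℝ, E) x →L[ℝ] TangentSpace 𝓘(ℝ, E) x →L[ℝ] ℝ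

/-- The differential `df(x)`, as a linear form on the tangent space at `x`. -/
def dform (f : M → ℝ) (x : M) : TangentSpace 𝓘(ℝ, E) x →L[ℝ] ℝ :=
  mfderiv 𝓘(ℝ, E) 𝓘(ℝ, ℝ) f x

/-- The gradient of `f` with respect to `g`: the vector field with `g (grad f) v = df v`. -/
def grad (g : FormField E M) (f : M → ℝ) (x : M) : TangentSpace 𝓘(ℝ, E) x :=
  (g x).inverse (dform f x)

/-- The differential at `y` of the inverse of the preferred chart around `p`. -/
def chartInvDeriv (p : M) (y : E) :
    E →L[ℝ] TangentSpace 𝓘(ℝ, E) ((extChartAt 𝓘(ℝ, E) p).symm y) :=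
  mfderiv 𝓘(ℝ, E) 𝓘(ℝ, E) (extChartAt 𝓘(ℝ, E) p).symm y

/-- The differential at `q` of the preferred chart around `p`. -/
def chartDeriv (p q : M) : TangentSpace 𝓘(ℝ, E) q →L[ℝ] E :=
  mfderiv 𝓘(ℝ, E) 𝓘(ℝ, E) (extChartAt 𝓘(ℝ, E) p) q

/-- The metric `g` written in the preferred chart around `p`: the matrix `(g_{uv})` at the
point of coordinates `y`, as a bilinear form on the model space. -/
def chartMetric (g : FormField E M) (p : M) (y : E) : E →L[ℝ] E →L[ℝ] ℝ :=
  (((chartInvDeriv p y).precomp ℝ).comp (g ((extChartAt 𝓘(ℝ, E) p).symm y))).comp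
    (chartInvDeriv p y)

/-- The vector field `X` written in the preferred chart around `p`. -/
def chartField (X : (q : M) → TangentSpace 𝓘(ℝ, E) q) (p : M) (y : E) : E :=
  chartDeriv p ((extChartAt 𝓘(ℝ, E) p).symm y) (X ((extChartAt 𝓘(ℝ, E) p).symm y))

/-- Christoffel symbols of the first kind in the preferred chart around `p`, as the bilinear form
`(a, c) ↦ Γ(a, b; c) = 1/2 (∂_a g(b, c) + ∂_b g(a, c) - ∂_c g(b, a))` for a fixed vector `b`,
see `christoffelLower_apply`. -/
def christoffelLower (g : FormField E M) (p : M) (y b : E) : E →L[ℝ] E →L[ℝ] ℝ :=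
  let D : E →L[ℝ] E →L[ℝ] E →L[ℝ] ℝ := fderiv ℝ (chartMetric g p) y
  (1 / 2 : ℝ) • (D.flip b + D b - (D.flip b).flip)

theorem christoffelLower_apply (g : FormField E M) (p : M) (y a b c : E) :
    christoffelLower g p y b a c =
      (1 / 2 : ℝ) * (fderiv ℝ (chartMetric g p) y a b c + fderiv ℝ (chartMetric g p) y b a c
        - fderiv ℝ (chartMetric g p) y c b a) := by
  simp [christoffelLower]

/-- Christoffel symbols of the second kind in the preferred chart around `p`, as the linear map
`a ↦ Γ(a, b)` for a fixed vector `b`, where `g (Γ(a, b)) c = Γ(a, b; c)`. -/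
def christoffel (g : FormField E M) (p : M) (y b : E) : E →L[ℝ] E :=
  (chartMetric g p y).inverse.comp (christoffelLower g p y b)

/-- The covariant derivative `u ↦ ∇_u X` at `p` of a vector field `X`, for the Levi-Civita
connection of `g`. In coordinates, `∇_u X = ∂_u X + Γ(u, X)`. -/
def covDeriv (g : FormField E M) (X : (q : M) → TangentSpace 𝓘(ℝ, E) q) (p : M) :
    TangentSpace 𝓘(ℝ, E) p →L[ℝ] TangentSpace 𝓘(ℝ, E) p :=
  let y : E := extChartAt 𝓘(ℝ, E) p p
  ContinuousLinearMap.comp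
    (mfderiv 𝓘(ℝ, E) 𝓘(ℝ, E) (extChartAt 𝓘(ℝ, E) p).symm y : E →L[ℝ] TangentSpace 𝓘(ℝ, E) p)
    ((fderiv ℝ (chartField X p) y + christoffel g p y (chartField X p y)).comp
      (chartDeriv p p))

/-- The Hessian operator `η ↦ ∇_η grad f` on the tangent space at `x`. -/
def hessOp (g : FormField E M) (f : M → ℝ) (x : M) :
    TangentSpace 𝓘(ℝ, E) x →L[ℝ] TangentSpace 𝓘(ℝ, E) x :=
  covDeriv g (grad g f) x

/-- The Riemannian Hessian: the covariant 2-tensor `(η, ξ) ↦ g(∇_η grad f, ξ)`. -/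
def hess (g : FormField E M) (f : M → ℝ) (x : M) :
    TangentSpace 𝓘(ℝ, E) x →L[ℝ] TangentSpace 𝓘(ℝ, E) x →L[ℝ] ℝ :=
  (g x).comp (hessOp g f x)

/-- The Gramian matrix of `(h_1, …, h_s)` and `(f_1, …, f_r)` at `x`, with entry
`⟨grad h_j, grad f_i⟩` in row `i` and column `j`. -/
def gram (g : FormField E M) {r s : ℕ} (f : Fin r → M → ℝ) (h : Fin s → M → ℝ) (x : M) :
    Matrix (Fin r) (Fin s) ℝ :=
  Matrix.of fun i j => g x (grad g (h j) x) (grad g (f i) x)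

/-- The Gram-determinant ratio `σ_i`: the numerator has `F_i` replaced by `G` in the column
functions. -/
def sigma (g : FormField E M) {k : ℕ} (F : Fin k → M → ℝ) (G : M → ℝ) (i : Fin k) (x : M) : ℝ :=
  (gram g F (Function.update F i G) x).det / (gram g F F x).det

/-- The components `F_1, …, F_k` of a map to `ℝ^k`. -/
def comps {k : ℕ} (F : M → EuclideanSpace ℝ (Fin k)) (i : Fin k) : M → ℝ := fun x => F x i

/-- `c` is a regular value of `F`: the differential is onto at every point of `F⁻¹(c)`. -/
def IsRegularValue (E : Type*) [NormedAddCommGroup E] [NormedSpace ℝ E]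
    {M : Type*} [TopologicalSpace M] [ChartedSpace E M] {k : ℕ}
    (F : M → EuclideanSpace ℝ (Fin k)) (c : EuclideanSpace ℝ (Fin k)) : Prop :=
  ∀ x : M, F x = c → Function.Surjective (mfderiv 𝓘(ℝ, E) 𝓘(ℝ, EuclideanSpace ℝ (Fin k)) F x)

end Manifold

section Submanifold

variable {E : Type*} [NormedAddCommGroup E] [NormedSpace ℝ E]
variable {M : Type*} [TopologicalSpace M] [ChartedSpace E M]
variable {E' : Type*} [NormedAddCommGroup E'] [NormedSpace ℝ E']
variable {S : Type*} [TopologicalSpace S] [ChartedSpace E' S]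

/-- The differential of the inclusion `j : S → M`, which identifies the tangent space of `S`
at `x` with a subspace of the tangent space of `M` at `j x`. -/
def incl (j : S → M) (x : S) : TangentSpace 𝓘(ℝ, E') x →L[ℝ] TangentSpace 𝓘(ℝ, E) (j x) :=
  mfderiv 𝓘(ℝ, E') 𝓘(ℝ, E) j x

/-- Restriction of a bilinear form on the tangent space of `M` at `j x` to the tangent space of
`S` at `x`. -/
def restrictForm (j : S → M) (x : S)
    (B : TangentSpace 𝓘(ℝ, E) (j x) →L[ℝ] TangentSpace 𝓘(ℝ, E) (j x) →L[ℝ] ℝ) :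
    TangentSpace 𝓘(ℝ, E') x →L[ℝ] TangentSpace 𝓘(ℝ, E') x →L[ℝ] ℝ :=
  (((incl j x).precomp ℝ).comp B).comp (incl j x)

theorem restrictForm_apply (j : S → M) (x : S)
    (B : TangentSpace 𝓘(ℝ, E) (j x) →L[ℝ] TangentSpace 𝓘(ℝ, E) (j x) →L[ℝ] ℝ)
    (u v : TangentSpace 𝓘(ℝ, E') x) :
    restrictForm j x B u v = B (incl j x u) (incl j x v) := rfl

/-- The metric induced on `S` by the metric `g` of `M`. -/
def inducedMetric (E' : Type*) [NormedAddCommGroup E'] [NormedSpace ℝ E']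
    {S : Type*} [TopologicalSpace S] [ChartedSpace E' S] (g : FormField E M) (j : S → M) : FormField E' S :=
  fun x => restrictForm j x (g (j x))

end Submanifold

end RiemHess

end

/-!
Everything is compared at one point through a Gauss formula for Hessians.

In coordinates, pairing the covariant derivative of a gradient with a vector gives
`Hess f (u, v) = ∂²f (u, v) - Γ(u, v; grad f)` with the Christoffel symbols of the first kind
(`IsMetricAt.hess_apply`); only the first derivative of the metric enters, and symmetry is visible.
If `J` is the inclusion `j` read in charts, then the Christoffel symbols of the pulled back metric
are `Γ(J'u, J'v; J'w) + ⟨J''(u, v), J'w⟩` (`christoffelForm_pullback`). Together with the second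
order chain rule this shows that
`Hess (f ∘ j) (u, v) = Hess f (dj u, dj v) + L (grad f - dj (grad (f ∘ j)))`
with a linear form `L` which depends on `u` and `v` but not on `f` (`exists_hess_comp_eq`): it is
the pairing with the second fundamental form.

The vector `grad f - dj (grad (f ∘ j))` is orthogonal to the image of `dj`, and this image is the
kernel of `dF` because the level set is regular and `j` is an embedding (`exists_incl_eq`). So the
normal part of `grad G` is a combination of the `grad F_i`, and Cramer's rule for the Gram matrix
identifies the coefficients as the `σ_i` (`apply_sub_cramer_eq_zero`). Since `F_i ∘ j` is constant,
the Gauss formula for `F_i` reads `L (grad F_i) = -Hess F_i (dj u, dj v)`. Substituting this in the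
Gauss formula for `G` gives the formula for the Hessian. At a critical point of `G ∘ j` the normal
part of `grad G` is `grad G` itself, and uniqueness of the multipliers is the linear independence of
the `grad F_i`.
-/

namespace RiemHess

/-! ### Gram matrices and positive definite forms -/

section LinearAlgebra

variable {V : Type*} [AddCommGroup V] [Module ℝ V]

theorem det_gram_ne_zero {k : ℕ} (B : V →ₗ[ℝ] V →ₗ[ℝ] ℝ) (hpos : ∀ v, v ≠ 0 → 0 < B v v)
    {n : Fin k → V} (hn : LinearIndependent ℝ n) :
    (Matrix.of fun i j => B (n j) (n i)).det ≠ 0 := by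
  intro h
  obtain ⟨l, hl, hl0⟩ := Matrix.exists_mulVec_eq_zero_iff.2 h
  have hN : ∑ j, l j • n j = 0 := by
    by_contra hne
    have h2 : B (∑ j, l j • n j) (∑ i, l i • n i) = 0 := by
      rw [map_sum (B (∑ j, l j • n j))]
      refine Finset.sum_eq_zero fun i _ => ?_
      have := congrFun hl0 i
      simp only [Matrix.mulVec, dotProduct, Matrix.of_apply, Pi.zero_apply] at this
      rw [map_smul, map_sum B, LinearMap.sum_apply]
      simp only [map_smul, LinearMap.smul_apply, smul_eq_mul]
      rw [mul_eq_zero]; right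
      rw [← this]
      exact Finset.sum_congr rfl fun j _ => mul_comm _ _
    exact (hpos _ hne).ne' h2
  exact hl (funext fun i => Fintype.linearIndependent_iff.1 hn l hN i)

/-- Cramer's rule: subtracting from `w` the combination of the `n i` whose coefficients are the
quotients of Gram determinants leaves a vector orthogonal to all `n r`. -/
theorem apply_sub_cramer_eq_zero {k : ℕ} (B : V →ₗ[ℝ] V →ₗ[ℝ] ℝ) {n : Fin k → V}
    (hdet : (Matrix.of fun i j => B (n j) (n i)).det ≠ 0) (w : V) (r : Fin k) :
    B (w - ∑ i, (((Matrix.of fun i j => B (n j) (n i)).updateCol i fun r => B w (n r)).det /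
      (Matrix.of fun i j => B (n j) (n i)).det) • n i) (n r) = 0 := by
  set A : Matrix (Fin k) (Fin k) ℝ := Matrix.of fun i j => B (n j) (n i) with hA
  have h := congrFun (Matrix.mulVec_cramer A fun r => B w (n r)) r
  simp only [Matrix.mulVec, dotProduct, Matrix.cramer_apply, Pi.smul_apply, smul_eq_mul] at h
  rw [map_sub, LinearMap.sub_apply, map_sum B, LinearMap.sum_apply, sub_eq_zero]
  simp only [map_smul, LinearMap.smul_apply, smul_eq_mul]
  rw [← mul_right_inj' hdet, ← h, Finset.mul_sum]
  refine Finset.sum_congr rfl fun i _ => ?_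
  rw [show A r i = B (n i) (n r) from rfl]
  field_simp

end LinearAlgebra

section TopologicalLinearAlgebra

variable {V : Type*} [AddCommGroup V] [Module ℝ V] [TopologicalSpace V] [IsTopologicalAddGroup V]
  [ContinuousSMul ℝ V] [T2Space V] [FiniteDimensional ℝ V]

theorem isInvertible_of_pos (B : V →L[ℝ] V →L[ℝ] ℝ) (hpos : ∀ v, v ≠ 0 → 0 < B v v) :
    B.IsInvertible := by
  have : FiniteDimensional ℝ (V →L[ℝ] ℝ) :=
    (LinearMap.toContinuousLinearMap (𝕜 := ℝ) (E := V) (F' := ℝ)).finiteDimensional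
  have hdim : Module.finrank ℝ V = Module.finrank ℝ (V →L[ℝ] ℝ) := by
    rw [← (LinearMap.toContinuousLinearMap (𝕜 := ℝ) (E := V) (F' := ℝ)).finrank_eq]
    exact (Subspace.dual_finrank_eq (K := ℝ) (V := V)).symm
  have hinj : Function.Injective (B : V →ₗ[ℝ] V →L[ℝ] ℝ) := by
    rw [injective_iff_map_eq_zero]
    intro v hv
    by_contra hne
    have hv' : B v = 0 := hv
    have := hpos v hne
    simp [hv'] at this
  exact ⟨(LinearEquiv.ofInjectiveOfFinrankEq
    (B : V →ₗ[ℝ] V →L[ℝ] ℝ) hinj hdim).toContinuousLinearEquiv, by ext; rfl⟩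

end TopologicalLinearAlgebra

/-! ### Christoffel symbols and Hessians in a vector space -/

section Flat

section Differentiability

variable {E V W Z : Type*} [NormedAddCommGroup E] [NormedSpace ℝ E] [NormedAddCommGroup V]
  [NormedSpace ℝ V] [NormedAddCommGroup W] [NormedSpace ℝ W] [NormedAddCommGroup Z]
  [NormedSpace ℝ Z]

theorem differentiableAt_clm_const_apply {A : E → V} {y : E} (T : V →L[ℝ] W)
    (hA : DifferentiableAt ℝ A y) : DifferentiableAt ℝ (fun z => T (A z)) y :=
  T.differentiableAt.comp y hA

theorem differentiableAt_precomp {A : E → V →L[ℝ] W} {y : E} (hA : DifferentiableAt ℝ A y) :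
    DifferentiableAt ℝ (fun z => ((A z).precomp Z : (W →L[ℝ] Z) →L[ℝ] V →L[ℝ] Z)) y :=
  differentiableAt_clm_const_apply (V := V →L[ℝ] W) (W := (W →L[ℝ] Z) →L[ℝ] V →L[ℝ] Z)
    (ContinuousLinearMap.compL ℝ V W Z).flip hA

theorem differentiableAt_inverse [CompleteSpace V] {A : E → V →L[ℝ] W} {y : E}
    (hA : DifferentiableAt ℝ A y) (hi : (A y).IsInvertible) :
    DifferentiableAt ℝ (fun z => (A z).inverse) y := by
  have h1 := (hi.contDiffAt_map_inverse (n := 1)).differentiableAt (by norm_num)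
  fun_prop

end Differentiability

variable {E : Type*} [NormedAddCommGroup E] [NormedSpace ℝ E]

/-- The Levi-Civita Christoffel symbols of the first kind, as a function of the derivative `D` of
the metric. -/
noncomputable def christoffelForm (D : E →L[ℝ] E →L[ℝ] E →L[ℝ] ℝ) (a b c : E) : ℝ :=
  (1 / 2 : ℝ) * (D a b c + D b a c - D c b a)

theorem christoffelForm_zero_right (D : E →L[ℝ] E →L[ℝ] E →L[ℝ] ℝ) (a b : E) :
    christoffelForm D a b 0 = 0 := by
  simp [christoffelForm]

theorem fderiv_symm_of_eventually {h : E → E →L[ℝ] E →L[ℝ] ℝ} {y : E}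
    (hsymm : ∀ᶠ z in nhds y, ∀ b c, h z b c = h z c b) (hd : DifferentiableAt ℝ h y) (a b c : E) :
    fderiv ℝ h y a b c = fderiv ℝ h y a c b := by
  have key : ∀ b c, HasFDerivAt (fun z => h z b c)
      (((fderiv ℝ h y).flip b).flip c) y := fun b c => by
    simpa using!
      (hd.hasFDerivAt.clm_apply (hasFDerivAt_const b y)).clm_apply (hasFDerivAt_const c y)
  have h2 : HasFDerivAt (fun z => h z b c) (((fderiv ℝ h y).flip c).flip b) y :=
    (key c b).congr_of_eventuallyEq (hsymm.mono fun z hz => hz b c)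
  exact DFunLike.congr_fun ((key b c).unique h2) a

/-- The coordinate expression of the Hessian. Here `X` is the gradient of `f`, and the left-hand
side is the metric applied to the covariant derivative of `X`. The derivative of `X` is computed
by differentiating the identity `h (X, ·) = df`. -/
theorem metric_fderiv_gradient_add_christoffelForm [CompleteSpace E]
    {h : E → E →L[ℝ] E →L[ℝ] ℝ} {y : E} {f : E → ℝ} {X : E → E}
    (hsymm : ∀ᶠ z in nhds y, ∀ b c, h z b c = h z c b) (hd : DifferentiableAt ℝ h y)
    (hinv : ∀ᶠ z in nhds y, (h z).IsInvertible) (hf : ContDiffAt ℝ 2 f y)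
    (hX : X =ᶠ[nhds y] fun z => (h z).inverse (fderiv ℝ f z)) (a b : E) :
    h y (fderiv ℝ X y a) b +
        christoffelForm (fderiv ℝ h y) a (X y) b =
      fderiv ℝ (fderiv ℝ f) y a b - christoffelForm (fderiv ℝ h y) a b (X y) := by
  have hdf : DifferentiableAt ℝ (fderiv ℝ f) y :=
    (hf.fderiv_right (m := 1) (by norm_num)).differentiableAt (by norm_num)
  have hXd : DifferentiableAt ℝ X y := by
    refine DifferentiableAt.congr_of_eventuallyEq ?_ hX
    have h2 := differentiableAt_inverse hd hinv.self_of_nhds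
    exact h2.clm_apply hdf
  have e1 : (fun z => h z (X z)) =ᶠ[nhds y] fderiv ℝ f := by
    filter_upwards [hX, hinv] with z hz hi
    obtain ⟨e, he⟩ := hi
    rw [hz, ← he]
    simp
  have h1 := (hd.hasFDerivAt.clm_apply hXd.hasFDerivAt).congr_of_eventuallyEq e1.symm
  have h2 := DFunLike.congr_fun (DFunLike.congr_fun (h1.unique hdf.hasFDerivAt) a) b
  simp only [add_apply, ContinuousLinearMap.comp_apply,
    ContinuousLinearMap.flip_apply] at h2
  have s := fderiv_symm_of_eventually hsymm hd
  simp only [christoffelForm]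
  rw [← h2, s b (X y) a, s a b (X y), s b a (X y), s (X y) b a]
  ring

variable {E' : Type*} [NormedAddCommGroup E'] [NormedSpace ℝ E']

theorem differentiableAt_pullback {h : E → E →L[ℝ] E →L[ℝ] ℝ} {J : E' → E} {y : E'}
    (hd : DifferentiableAt ℝ h (J y)) (hJ : ContDiffAt ℝ 2 J y) :
    DifferentiableAt ℝ
      (fun z => (((fderiv ℝ J z).precomp ℝ).comp (h (J z))).comp (fderiv ℝ J z)) y := by
  have hdJ : DifferentiableAt ℝ (fderiv ℝ J) y :=
    (hJ.fderiv_right (m := 1) (by norm_num)).differentiableAt (by norm_num)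
  have hJd : DifferentiableAt ℝ J y := hJ.differentiableAt (by norm_num)
  have h1 : DifferentiableAt ℝ (fun z => h (J z)) y :=
    DifferentiableAt.comp (G := E →L[ℝ] E →L[ℝ] ℝ) y hd hJd
  have h2 := differentiableAt_precomp (Z := ℝ) hdJ
  exact (h2.clm_comp h1).clm_comp hdJ

/-- Transformation rule of the Christoffel symbols of the first kind under pullback by a map `J`
which need not be a local diffeomorphism. -/
theorem christoffelForm_pullback {h : E → E →L[ℝ] E →L[ℝ] ℝ} {h' : E' → E' →L[ℝ] E' →L[ℝ] ℝ}
    {J : E' → E} {y : E'}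
    (hsymm : ∀ b c, h (J y) b c = h (J y) c b)
    (hd : DifferentiableAt ℝ h (J y)) (hJ : ContDiffAt ℝ 2 J y)
    (hh' : h' =ᶠ[nhds y]
      fun z => (((fderiv ℝ J z).precomp ℝ).comp (h (J z))).comp (fderiv ℝ J z)) (a b c : E') :
    christoffelForm (fderiv ℝ h' y) a b c =
      christoffelForm (fderiv ℝ h (J y)) (fderiv ℝ J y a) (fderiv ℝ J y b) (fderiv ℝ J y c) +
        h (J y) (fderiv ℝ (fderiv ℝ J) y a b) (fderiv ℝ J y c) := by
  have hdJ : DifferentiableAt ℝ (fderiv ℝ J) y :=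
    (hJ.fderiv_right (m := 1) (by norm_num)).differentiableAt (by norm_num)
  have hJd : DifferentiableAt ℝ J y := hJ.differentiableAt (by norm_num)
  have hd' := (differentiableAt_pullback hd hJ).congr_of_eventuallyEq hh'
  have hJ2 : ∀ a b, fderiv ℝ (fderiv ℝ J) y a b = fderiv ℝ (fderiv ℝ J) y b a :=
    fun a b => (hJ.isSymmSndFDerivAt (by simp)) a b
  have key : ∀ a b c, fderiv ℝ h' y a b c =
      fderiv ℝ h (J y) (fderiv ℝ J y a) (fderiv ℝ J y b) (fderiv ℝ J y c) +
        h (J y) (fderiv ℝ (fderiv ℝ J) y a b) (fderiv ℝ J y c) +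
        h (J y) (fderiv ℝ J y b) (fderiv ℝ (fderiv ℝ J) y a c) := by
    intro a b c
    have k1 := (hd'.hasFDerivAt.clm_apply (hasFDerivAt_const b y)).clm_apply
      (hasFDerivAt_const c y)
    have hv : ∀ b : E',
        HasFDerivAt (fun z => fderiv ℝ J z b) ((fderiv ℝ (fderiv ℝ J) y).flip b) y := fun b =>
      by simpa using! hdJ.hasFDerivAt.clm_apply (hasFDerivAt_const b y)
    have hhJ : HasFDerivAt (fun z => h (J z)) ((fderiv ℝ h (J y)).comp (fderiv ℝ J y)) y :=
      HasFDerivAt.comp (G := E →L[ℝ] E →L[ℝ] ℝ) y hd.hasFDerivAt hJd.hasFDerivAt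
    have k2 := (hhJ.clm_apply (hv b)).clm_apply (hv c)
    have k3 := k2.congr_of_eventuallyEq (f₁ := fun z => h' z b c)
      (hh'.mono fun z hz => by simp [hz])
    have := DFunLike.congr_fun (k1.unique k3) a
    simp at this
    rw [this]; ring
  simp only [christoffelForm, key]
  rw [hJ2 b a, hJ2 c b, hJ2 c a, hsymm (fderiv ℝ J y a), hsymm (fderiv ℝ J y b),
    hsymm _ (fderiv ℝ J y a)]
  ring

theorem fderiv_fderiv_comp {f : E → ℝ} {J : E' → E} {y : E'} (hf : ContDiffAt ℝ 2 f (J y))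
    (hJ : ContDiffAt ℝ 2 J y) (a b : E') :
    fderiv ℝ (fderiv ℝ (f ∘ J)) y a b =
      fderiv ℝ (fderiv ℝ f) (J y) (fderiv ℝ J y a) (fderiv ℝ J y b) +
        fderiv ℝ f (J y) (fderiv ℝ (fderiv ℝ J) y a b) := by
  have hdJ : DifferentiableAt ℝ (fderiv ℝ J) y :=
    (hJ.fderiv_right (m := 1) (by norm_num)).differentiableAt (by norm_num)
  have hJd : DifferentiableAt ℝ J y := hJ.differentiableAt (by norm_num)
  have hdf : DifferentiableAt ℝ (fderiv ℝ f) (J y) :=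
    (hf.fderiv_right (m := 1) (by norm_num)).differentiableAt (by norm_num)
  have e : fderiv ℝ (f ∘ J) =ᶠ[nhds y] fun z => (fderiv ℝ f (J z)).comp (fderiv ℝ J z) := by
    have h1 := hJ.eventually (by simp)
    have h2 := hJ.continuousAt.eventually (hf.eventually (by simp))
    filter_upwards [h1, h2] with z hz1 hz2
    exact fderiv_comp z (hz2.differentiableAt (by norm_num)) (hz1.differentiableAt (by norm_num))
  have hfJ : HasFDerivAt (fun z => fderiv ℝ f (J z))
      ((fderiv ℝ (fderiv ℝ f) (J y)).comp (fderiv ℝ J y)) y :=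
    hdf.hasFDerivAt.comp y hJd.hasFDerivAt
  have k := hfJ.clm_comp hdJ.hasFDerivAt
  rw [e.fderiv_eq, HasFDerivAt.fderiv k]
  simp
  ring

end Flat

/-! ### Metrics, gradients and Hessians in a chart -/

section Charts

variable {E : Type*} [NormedAddCommGroup E] [NormedSpace ℝ E]
variable {M : Type*} [TopologicalSpace M] [ChartedSpace E M]

/-- The regularity of a field of bilinear forms which the coordinate formula for the Hessian at
`p` requires: it is symmetric and positive definite everywhere, and differentiable at `p`. -/
structure IsMetricAt (g : FormField E M) (p : M) : Prop where
  symm : ∀ (q : M) (v w : TangentSpace 𝓘(ℝ, E) q), g q v w = g q w v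
  pos : ∀ (q : M) (v : TangentSpace 𝓘(ℝ, E) q), v ≠ 0 → 0 < g q v v
  differentiableAt : DifferentiableAt ℝ (chartMetric g p) (extChartAt 𝓘(ℝ, E) p p)

/-- `TangentSpace` at any point is the model space `E`, so the arguments of a form can be kept
while its base point is replaced by an equal one. -/
theorem form_congr (g : FormField E M) {q q' : M} (h : q = q') (a b : E) :
    (g q : E →L[ℝ] E →L[ℝ] ℝ) a b = (g q' : E →L[ℝ] E →L[ℝ] ℝ) a b := by
  subst h; rfl

theorem eventually_mem_target (p : M) :
    ∀ᶠ y in nhds (extChartAt 𝓘(ℝ, E) p p), y ∈ (extChartAt 𝓘(ℝ, E) p).target :=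
  extChartAt_target_mem_nhds (I := 𝓘(ℝ, E)) p

section Manifold

variable [IsManifold 𝓘(ℝ, E) ∞ M]

theorem chartDeriv_chartInvDeriv {p : M} {y : E} (hy : y ∈ (extChartAt 𝓘(ℝ, E) p).target) (a : E) :
    chartDeriv p ((extChartAt 𝓘(ℝ, E) p).symm y) (chartInvDeriv p y a) = a := by
  have : IsManifold 𝓘(ℝ, E) 1 M := IsManifold.of_le (n := ∞) (by simp)
  have h := mfderiv_extChartAt_comp_mfderivWithin_extChartAt_symm (I := 𝓘(ℝ, E)) hy
  rw [ModelWithCorners.range_eq_univ, mfderivWithin_univ] at h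
  exact DFunLike.congr_fun h a

theorem chartInvDeriv_chartDeriv {p : M} {y : E} (hy : y ∈ (extChartAt 𝓘(ℝ, E) p).target)
    (v : TangentSpace 𝓘(ℝ, E) ((extChartAt 𝓘(ℝ, E) p).symm y)) :
    chartInvDeriv p y (chartDeriv p ((extChartAt 𝓘(ℝ, E) p).symm y) v) = v := by
  have : IsManifold 𝓘(ℝ, E) 1 M := IsManifold.of_le (n := ∞) (by simp)
  have h := mfderivWithin_extChartAt_symm_comp_mfderiv_extChartAt (I := 𝓘(ℝ, E)) hy
  rw [ModelWithCorners.range_eq_univ, mfderivWithin_univ] at h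
  exact DFunLike.congr_fun h v

theorem chartDeriv_self (p : M) : (chartDeriv p p : E →L[ℝ] E) = ContinuousLinearMap.id ℝ E := by
  have : IsManifold 𝓘(ℝ, E) 1 M := IsManifold.of_le (n := ∞) (by simp)
  exact mfderiv_extChartAt_self (I := 𝓘(ℝ, E)) (x := p)

theorem chartInvDeriv_self (p : M) :
    (chartInvDeriv p (extChartAt 𝓘(ℝ, E) p p) : E →L[ℝ] E) = ContinuousLinearMap.id ℝ E := by
  have : IsManifold 𝓘(ℝ, E) 1 M := IsManifold.of_le (n := ∞) (by simp)
  have h := mfderivWithin_range_extChartAt_symm (I := 𝓘(ℝ, E)) (x := p)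
  rw [ModelWithCorners.range_eq_univ, mfderivWithin_univ] at h
  exact h

theorem chartMetric_self (g : FormField E M) (p : M) (a b : E) :
    chartMetric g p (extChartAt 𝓘(ℝ, E) p p) a b = (g p : E →L[ℝ] E →L[ℝ] ℝ) a b := by
  have h : ∀ c : E, (chartInvDeriv p (extChartAt 𝓘(ℝ, E) p p) : E →L[ℝ] E) c = c := fun c => by
    rw [chartInvDeriv_self]; rfl
  calc chartMetric g p (extChartAt 𝓘(ℝ, E) p p) a b
      = (g ((extChartAt 𝓘(ℝ, E) p).symm (extChartAt 𝓘(ℝ, E) p p)) : E →L[ℝ] E →L[ℝ] ℝ)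
        ((chartInvDeriv p (extChartAt 𝓘(ℝ, E) p p) : E →L[ℝ] E) a)
        ((chartInvDeriv p (extChartAt 𝓘(ℝ, E) p p) : E →L[ℝ] E) b) := rfl
    _ = _ := by rw [h, h, form_congr g (extChartAt_to_inv (I := 𝓘(ℝ, E)) p)]

theorem chartField_self (X : (q : M) → TangentSpace 𝓘(ℝ, E) q) (p : M) :
    chartField X p (extChartAt 𝓘(ℝ, E) p p) = X p := by
  have h : ∀ q, q = p → (chartDeriv p q (X q) : E) = X p := by
    rintro q rfl
    exact DFunLike.congr_fun (chartDeriv_self q) (X q)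
  exact h _ (extChartAt_to_inv (I := 𝓘(ℝ, E)) p)

theorem mdifferentiableAt_extChartAt_symm {p : M} {y : E}
    (hy : y ∈ (extChartAt 𝓘(ℝ, E) p).target) :
    MDifferentiableAt 𝓘(ℝ, E) 𝓘(ℝ, E) (extChartAt 𝓘(ℝ, E) p).symm y :=
  ((contMDiffOn_extChartAt_symm (I := 𝓘(ℝ, E)) (n := ∞) p).contMDiffAt
    ((isOpen_extChartAt_target (I := 𝓘(ℝ, E)) p).mem_nhds hy)).mdifferentiableAt (by simp)

theorem contMDiffAt_extChartAt_symm_self (p : M) :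
    ContMDiffAt 𝓘(ℝ, E) 𝓘(ℝ, E) ∞ (extChartAt 𝓘(ℝ, E) p).symm (extChartAt 𝓘(ℝ, E) p p) :=
  (contMDiffOn_extChartAt_symm (I := 𝓘(ℝ, E)) (n := ∞) p).contMDiffAt
    (eventually_mem_target p)

theorem fderiv_comp_extChartAt_symm {f : M → ℝ} (hf : ContMDiff 𝓘(ℝ, E) 𝓘(ℝ, ℝ) ∞ f) {p : M}
    {y : E} (hy : y ∈ (extChartAt 𝓘(ℝ, E) p).target) (a : E) :
    fderiv ℝ (f ∘ (extChartAt 𝓘(ℝ, E) p).symm) y a =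
      dform f ((extChartAt 𝓘(ℝ, E) p).symm y) (chartInvDeriv p y a) := by
  have h := mfderiv_comp y ((hf _).mdifferentiableAt (by simp))
    (mdifferentiableAt_extChartAt_symm hy)
  rw [mfderiv_eq_fderiv] at h
  exact DFunLike.congr_fun h a

theorem contDiffAt_comp_extChartAt_symm {f : M → ℝ} (hf : ContMDiff 𝓘(ℝ, E) 𝓘(ℝ, ℝ) ∞ f) (p : M) :
    ContDiffAt ℝ 2 (f ∘ (extChartAt 𝓘(ℝ, E) p).symm) (extChartAt 𝓘(ℝ, E) p p) := by
  have h := (hf _).comp _ (contMDiffAt_extChartAt_symm_self (E := E) p)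
  exact (contMDiffAt_iff_contDiffAt.1 h).of_le ENat.LEInfty.out

variable [FiniteDimensional ℝ E]

omit [IsManifold 𝓘(ℝ, E) ∞ M] in
theorem IsMetricAt.isInvertible {g : FormField E M} {p : M} (hg : IsMetricAt g p) (q : M) :
    (g q).IsInvertible := by
  have : T2Space (TangentSpace 𝓘(ℝ, E) q) := inferInstanceAs (T2Space E)
  have : FiniteDimensional ℝ (TangentSpace 𝓘(ℝ, E) q) := inferInstanceAs (FiniteDimensional ℝ E)
  exact isInvertible_of_pos (g q) (hg.pos q)

omit [IsManifold 𝓘(ℝ, E) ∞ M] in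
theorem IsMetricAt.apply_grad {g : FormField E M} {p : M} (hg : IsMetricAt g p) (f : M → ℝ)
    (q : M) : g q (grad g f q) = dform f q := by
  obtain ⟨e, he⟩ := hg.isInvertible q
  rw [grad, ← he]
  simp

theorem IsMetricAt.isInvertible_chartMetric {g : FormField E M} {p : M} (hg : IsMetricAt g p)
    {y : E} (hy : y ∈ (extChartAt 𝓘(ℝ, E) p).target) : (chartMetric g p y).IsInvertible := by
  refine isInvertible_of_pos _ fun v hv => hg.pos _ (chartInvDeriv p y v) fun h0 => hv ?_
  have := chartDeriv_chartInvDeriv hy v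
  rw [h0, map_zero] at this
  exact this.symm

theorem IsMetricAt.chartField_grad {g : FormField E M} {p : M} (hg : IsMetricAt g p) {f : M → ℝ}
    (hf : ContMDiff 𝓘(ℝ, E) 𝓘(ℝ, ℝ) ∞ f) {y : E} (hy : y ∈ (extChartAt 𝓘(ℝ, E) p).target) :
    chartField (grad g f) p y =
      (chartMetric g p y).inverse (fderiv ℝ (f ∘ (extChartAt 𝓘(ℝ, E) p).symm) y) := by
  have h : fderiv ℝ (f ∘ (extChartAt 𝓘(ℝ, E) p).symm) y =
      chartMetric g p y (chartField (grad g f) p y) := by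
    ext b
    rw [fderiv_comp_extChartAt_symm hf hy, ← hg.apply_grad]
    change _ = g _ (chartInvDeriv p y (chartDeriv p _ (grad g f _))) (chartInvDeriv p y b)
    rw [chartInvDeriv_chartDeriv hy]
  obtain ⟨e, he⟩ := hg.isInvertible_chartMetric hy
  rw [h, ← he]
  simp

omit [FiniteDimensional ℝ E] in
theorem hess_eq_chartMetric (g : FormField E M) (f : M → ℝ) (p : M) (u v : E) :
    (hess g f p : E →L[ℝ] E →L[ℝ] ℝ) u v =
      chartMetric g p (extChartAt 𝓘(ℝ, E) p p)
        (fderiv ℝ (chartField (grad g f) p) (extChartAt 𝓘(ℝ, E) p p) u +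
          christoffel g p (extChartAt 𝓘(ℝ, E) p p)
            (chartField (grad g f) p (extChartAt 𝓘(ℝ, E) p p)) u) v := by
  have h1 : ∀ c : E, (chartInvDeriv p (extChartAt 𝓘(ℝ, E) p p) : E →L[ℝ] E) c = c := fun c => by
    rw [chartInvDeriv_self]; rfl
  have h2 : ∀ c : E, (chartDeriv p p : E →L[ℝ] E) c = c := fun c => by
    rw [chartDeriv_self]; rfl
  have h3 : (hess g f p : E →L[ℝ] E →L[ℝ] ℝ) u v = (g p : E →L[ℝ] E →L[ℝ] ℝ)
      ((chartInvDeriv p (extChartAt 𝓘(ℝ, E) p p) : E →L[ℝ] E)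
        ((fderiv ℝ (chartField (grad g f) p) (extChartAt 𝓘(ℝ, E) p p) +
          christoffel g p (extChartAt 𝓘(ℝ, E) p p)
            (chartField (grad g f) p (extChartAt 𝓘(ℝ, E) p p)))
          ((chartDeriv p p : E →L[ℝ] E) u))) v := rfl
  rw [h3, h1, h2, chartMetric_self]
  rfl

theorem IsMetricAt.chartMetric_christoffel {g : FormField E M} {p : M} (hg : IsMetricAt g p)
    (X u v : E) :
    chartMetric g p (extChartAt 𝓘(ℝ, E) p p)
      (christoffel g p (extChartAt 𝓘(ℝ, E) p p) X u) v =
      christoffelForm (fderiv ℝ (chartMetric g p) (extChartAt 𝓘(ℝ, E) p p)) u X v := by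
  obtain ⟨e, he⟩ := hg.isInvertible_chartMetric (mem_extChartAt_target (I := 𝓘(ℝ, E)) p)
  have h := christoffelLower_apply g p (extChartAt 𝓘(ℝ, E) p p) u X v
  rw [christoffelForm, ← h, christoffel, ContinuousLinearMap.comp_apply, ← he]
  simp

/-- The Hessian in coordinates: `∂²f` minus the Christoffel symbols paired with the gradient. -/
theorem IsMetricAt.hess_apply {g : FormField E M} {p : M} (hg : IsMetricAt g p) {f : M → ℝ}
    (hf : ContMDiff 𝓘(ℝ, E) 𝓘(ℝ, ℝ) ∞ f) (u v : E) :
    (hess g f p : E →L[ℝ] E →L[ℝ] ℝ) u v =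
      fderiv ℝ (fderiv ℝ (f ∘ (extChartAt 𝓘(ℝ, E) p).symm)) (extChartAt 𝓘(ℝ, E) p p) u v -
        christoffelForm (fderiv ℝ (chartMetric g p) (extChartAt 𝓘(ℝ, E) p p)) u v
          (grad g f p) := by
  have hcomplete : CompleteSpace E := FiniteDimensional.complete ℝ E
  have key := metric_fderiv_gradient_add_christoffelForm (h := chartMetric g p)
    (y := extChartAt 𝓘(ℝ, E) p p)
    (X := chartField (grad g f) p)
    (Filter.Eventually.of_forall fun z b c => hg.symm _ (chartInvDeriv p z b) (chartInvDeriv p z c))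
    hg.differentiableAt
    ((eventually_mem_target p).mono fun z hz => hg.isInvertible_chartMetric hz)
    (contDiffAt_comp_extChartAt_symm hf p)
    ((eventually_mem_target p).mono fun z hz => hg.chartField_grad hf hz) u v
  rw [hess_eq_chartMetric, map_add, add_apply, hg.chartMetric_christoffel, key, chartField_self]

end Manifold

end Charts

/-! ### The induced metric and the Gauss formula -/

variable {E : Type*} [NormedAddCommGroup E] [NormedSpace ℝ E]
  {M : Type*} [TopologicalSpace M] [ChartedSpace E M] [IsManifold 𝓘(ℝ, E) ∞ M]
  {E' : Type*} [NormedAddCommGroup E'] [NormedSpace ℝ E']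
  {S : Type*} [TopologicalSpace S] [ChartedSpace E' S] [IsManifold 𝓘(ℝ, E') ∞ S]

/-- A smooth Riemannian metric is differentiable in charts: the inverse trivialization of the
tangent bundle at `p` is the differential of the inverse of the chart. -/
theorem isMetricAt_riemannianMetric
    (g : Bundle.ContMDiffRiemannianMetric 𝓘(ℝ, E) ∞ E (fun x : M => TangentSpace 𝓘(ℝ, E) x))
    (p : M) : IsMetricAt g.inner p := by
  have : IsManifold 𝓘(ℝ, E) 1 M := IsManifold.of_le (n := ∞) (by simp)
  refine ⟨g.symm, g.pos, ?_⟩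
  have h1 := ((contMDiffAt_hom_bundle _).1 (g.contMDiff p)).2
  have h2 := ContMDiffAt.comp (extChartAt 𝓘(ℝ, E) p p)
    (by rw [extChartAt_to_inv (I := 𝓘(ℝ, E)) p]; exact h1)
    (contMDiffAt_extChartAt_symm_self (E := E) p)
  refine ((contMDiffAt_iff_contDiffAt.1 h2).differentiableAt (by simp)).congr_of_eventuallyEq ?_
  filter_upwards [eventually_mem_target p] with y hy
  have hs : (extChartAt 𝓘(ℝ, E) p).symm y ∈ (chartAt E p).source := by
    have := (extChartAt 𝓘(ℝ, E) p).map_target hy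
    rwa [extChartAt_source] at this
  have hsymm : ∀ a : E, (trivializationAt E (TangentSpace 𝓘(ℝ, E)) p).symm
      ((extChartAt 𝓘(ℝ, E) p).symm y) a = chartInvDeriv p y a := by
    intro a
    have h := TangentBundle.symmL_trivializationAt (I := 𝓘(ℝ, E)) hs
    rw [ModelWithCorners.range_eq_univ, mfderivWithin_univ,
      (extChartAt 𝓘(ℝ, E) p).right_inv hy] at h
    rw [← Bundle.Trivialization.symmL_apply (R := ℝ) _ (by simpa using hs), h]
    rfl
  ext a b
  simp only [Function.comp_apply]
  rw [inCoordinates_apply_eq₂ (by simpa using hs) (by simpa using hs) (by simp)]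
  rw [hsymm, hsymm]
  simp
  rfl

section Pullback

/-- The map `j` written in the preferred charts around `x` and `j x`. -/
noncomputable def chartMap (E E' : Type*) [NormedAddCommGroup E] [NormedSpace ℝ E]
    [NormedAddCommGroup E'] [NormedSpace ℝ E']
    {M : Type*} [TopologicalSpace M] [ChartedSpace E M]
    {S : Type*} [TopologicalSpace S] [ChartedSpace E' S] (j : S → M) (x : S) : E' → E :=
  extChartAt 𝓘(ℝ, E) (j x) ∘ j ∘ (extChartAt 𝓘(ℝ, E') x).symm

variable {j : S → M}

omit [IsManifold 𝓘(ℝ, E) ∞ M] [IsManifold 𝓘(ℝ, E') ∞ S] in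
theorem chartMap_self (x : S) :
    chartMap E E' j x (extChartAt 𝓘(ℝ, E') x x) = extChartAt 𝓘(ℝ, E) (j x) (j x) := by
  simp [chartMap]

omit [IsManifold 𝓘(ℝ, E) ∞ M] in
theorem contMDiffAt_comp_extChartAt_symm_self (hj : ContMDiff 𝓘(ℝ, E') 𝓘(ℝ, E) ∞ j) (x : S) :
    ContMDiffAt 𝓘(ℝ, E') 𝓘(ℝ, E) ∞ (j ∘ (extChartAt 𝓘(ℝ, E') x).symm)
      (extChartAt 𝓘(ℝ, E') x x) :=
  (hj _).comp _ (contMDiffAt_extChartAt_symm_self (E := E') x)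

theorem contDiffAt_chartMap (hj : ContMDiff 𝓘(ℝ, E') 𝓘(ℝ, E) ∞ j) (x : S) :
    ContDiffAt ℝ 2 (chartMap E E' j x) (extChartAt 𝓘(ℝ, E') x x) := by
  have h : ContMDiffAt 𝓘(ℝ, E') 𝓘(ℝ, E) ∞ (chartMap E E' j x) (extChartAt 𝓘(ℝ, E') x x) := by
    refine ContMDiffAt.comp _ ?_ (contMDiffAt_comp_extChartAt_symm_self hj x)
    refine contMDiffAt_extChartAt' ?_
    simp
  exact (contMDiffAt_iff_contDiffAt.1 h).of_le ENat.LEInfty.out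

omit [IsManifold 𝓘(ℝ, E) ∞ M] in
theorem eventually_map_mem_source (hj : ContMDiff 𝓘(ℝ, E') 𝓘(ℝ, E) ∞ j) (x : S) :
    ∀ᶠ z in nhds (extChartAt 𝓘(ℝ, E') x x),
      j ((extChartAt 𝓘(ℝ, E') x).symm z) ∈ (extChartAt 𝓘(ℝ, E) (j x)).source := by
  refine (contMDiffAt_comp_extChartAt_symm_self hj x).continuousAt.eventually ?_
  have : (j ∘ (extChartAt 𝓘(ℝ, E') x).symm) (extChartAt 𝓘(ℝ, E') x x) = j x := by simp
  rw [this]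
  exact extChartAt_source_mem_nhds (I := 𝓘(ℝ, E)) (j x)

omit [IsManifold 𝓘(ℝ, E) ∞ M] in
theorem extChartAt_symm_comp_chartMap (hj : ContMDiff 𝓘(ℝ, E') 𝓘(ℝ, E) ∞ j) (x : S) :
    (extChartAt 𝓘(ℝ, E) (j x)).symm ∘ chartMap E E' j x =ᶠ[nhds (extChartAt 𝓘(ℝ, E') x x)]
      j ∘ (extChartAt 𝓘(ℝ, E') x).symm := by
  filter_upwards [eventually_map_mem_source hj x] with z hz
  simp only [Function.comp_apply, chartMap]
  exact (extChartAt 𝓘(ℝ, E) (j x)).left_inv hz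

/-- The chain rule for `j` in charts. -/
theorem eventually_chartInvDeriv_chartMap (hj : ContMDiff 𝓘(ℝ, E') 𝓘(ℝ, E) ∞ j) (x : S) :
    ∀ᶠ z in nhds (extChartAt 𝓘(ℝ, E') x x), ∀ a : E',
      (chartInvDeriv (j x) (chartMap E E' j x z) : E →L[ℝ] E)
        (fderiv ℝ (chartMap E E' j x) z a) =
      (incl (E := E) j ((extChartAt 𝓘(ℝ, E') x).symm z) : E' →L[ℝ] E)
        ((chartInvDeriv x z : E' →L[ℝ] E') a) := by
  have hJ : ∀ᶠ z in nhds (extChartAt 𝓘(ℝ, E') x x),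
      DifferentiableAt ℝ (chartMap E E' j x) z :=
    ((contDiffAt_chartMap hj x).eventually (by simp)).mono fun z hz =>
      hz.differentiableAt (by norm_num)
  filter_upwards [eventually_mem_target x, hJ, eventually_map_mem_source hj x,
    (extChartAt_symm_comp_chartMap hj x).eventuallyEq_nhds] with z hz hJz hs he a
  have hJt : chartMap E E' j x z ∈ (extChartAt 𝓘(ℝ, E) (j x)).target :=
    (extChartAt 𝓘(ℝ, E) (j x)).map_source hs
  have h1 := mfderiv_comp z (mdifferentiableAt_extChartAt_symm hJt)
    hJz.mdifferentiableAt
  have h2 := mfderiv_comp z ((hj _).mdifferentiableAt (by simp))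
    (mdifferentiableAt_extChartAt_symm hz)
  have h3 := he.mfderiv_eq (I := 𝓘(ℝ, E')) (I' := 𝓘(ℝ, E))
  rw [mfderiv_eq_fderiv] at h1
  have e1 := DFunLike.congr_fun h1 a
  have e2 := DFunLike.congr_fun h2 a
  have e3 := DFunLike.congr_fun h3 a
  exact e1.symm.trans (e3.trans e2)

theorem incl_eq_fderiv_chartMap (hj : ContMDiff 𝓘(ℝ, E') 𝓘(ℝ, E) ∞ j) (x : S) (a : E') :
    (incl (E := E) j x : E' →L[ℝ] E) a =
      fderiv ℝ (chartMap E E' j x) (extChartAt 𝓘(ℝ, E') x x) a := by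
  have h := (eventually_chartInvDeriv_chartMap hj x).self_of_nhds a
  have h1 : ∀ c : E, (chartInvDeriv (j x) (extChartAt 𝓘(ℝ, E) (j x) (j x)) : E →L[ℝ] E) c = c :=
    fun c => by rw [chartInvDeriv_self]; rfl
  have h2 : ∀ c : E', (chartInvDeriv x (extChartAt 𝓘(ℝ, E') x x) : E' →L[ℝ] E') c = c :=
    fun c => by rw [chartInvDeriv_self]; rfl
  have h3 : ∀ q, q = x → ∀ c : E', (incl (E := E) j q : E' →L[ℝ] E) c =
      (incl (E := E) j x : E' →L[ℝ] E) c := by rintro q rfl c; rfl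
  rw [chartMap_self, h1, h2, h3 _ (extChartAt_to_inv (I := 𝓘(ℝ, E')) x)] at h
  exact h.symm

/-- In charts, the induced metric is the pullback of the metric by the map `j` read in charts. -/
theorem chartMetric_inducedMetric (hj : ContMDiff 𝓘(ℝ, E') 𝓘(ℝ, E) ∞ j) (g : FormField E M)
    (x : S) :
    chartMetric (inducedMetric E' g j) x =ᶠ[nhds (extChartAt 𝓘(ℝ, E') x x)]
      fun z => (((fderiv ℝ (chartMap E E' j x) z).precomp ℝ).comp
        (chartMetric g (j x) (chartMap E E' j x z))).comp (fderiv ℝ (chartMap E E' j x) z) := by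
  filter_upwards [eventually_chartInvDeriv_chartMap hj x, extChartAt_symm_comp_chartMap hj x]
    with z hz he
  ext a b
  change (g _ : E →L[ℝ] E →L[ℝ] ℝ)
      ((incl (E := E) j ((extChartAt 𝓘(ℝ, E') x).symm z) : E' →L[ℝ] E)
        ((chartInvDeriv x z : E' →L[ℝ] E') a))
      ((incl (E := E) j ((extChartAt 𝓘(ℝ, E') x).symm z) : E' →L[ℝ] E)
        ((chartInvDeriv x z : E' →L[ℝ] E') b)) =
    (g _ : E →L[ℝ] E →L[ℝ] ℝ)
      ((chartInvDeriv (j x) (chartMap E E' j x z) : E →L[ℝ] E)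
        (fderiv ℝ (chartMap E E' j x) z a))
      ((chartInvDeriv (j x) (chartMap E E' j x z) : E →L[ℝ] E)
        (fderiv ℝ (chartMap E E' j x) z b))
  rw [hz, hz]
  exact form_congr g he.symm _ _

theorem IsMetricAt.inducedMetric {g : FormField E M} {x : S} (hg : IsMetricAt g (j x))
    (hj : ContMDiff 𝓘(ℝ, E') 𝓘(ℝ, E) ∞ j)
    (hinj : ∀ s, Function.Injective (incl (E := E) (E' := E') j s)) :
    IsMetricAt (inducedMetric E' g j) x where
  symm q v w := hg.symm (j q) (incl j q v) (incl j q w)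
  pos q v hv := hg.pos (j q) (incl j q v) fun h0 => hv (hinj q (h0.trans (map_zero _).symm))
  differentiableAt := by
    refine (differentiableAt_pullback ?_ (contDiffAt_chartMap hj x)).congr_of_eventuallyEq
      (chartMetric_inducedMetric hj g x)
    rw [chartMap_self]
    exact hg.differentiableAt

variable [FiniteDimensional ℝ E] [FiniteDimensional ℝ E']

/-- The Gauss formula for Hessians: the Hessian of a restricted function differs from the
restriction of the Hessian by a linear form in the normal part of the gradient, and this form
(the second fundamental form evaluated at `u` and `v`) does not depend on the function. -/
theorem exists_hess_comp_eq {g : FormField E M} {x : S} (hg : IsMetricAt g (j x))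
    (hj : ContMDiff 𝓘(ℝ, E') 𝓘(ℝ, E) ∞ j)
    (hinj : ∀ s, Function.Injective (incl (E := E) (E' := E') j s)) (u v : E') :
    ∃ L : E →ₗ[ℝ] ℝ, ∀ f : M → ℝ, ContMDiff 𝓘(ℝ, E) 𝓘(ℝ, ℝ) ∞ f →
      (hess (inducedMetric E' g j) (f ∘ j) x : E' →L[ℝ] E' →L[ℝ] ℝ) u v =
        (restrictForm j x (hess g f (j x)) : E' →L[ℝ] E' →L[ℝ] ℝ) u v +
          (L (grad g f (j x)) -
            L ((incl (E := E) j x : E' →L[ℝ] E) (grad (inducedMetric E' g j) (f ∘ j) x))) := by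
  set y := extChartAt 𝓘(ℝ, E) (j x) (j x) with hy
  set y' := extChartAt 𝓘(ℝ, E') x x with hy'
  set J := chartMap E E' j x with hJdef
  have hJy : J y' = y := chartMap_self x
  have hJ : ContDiffAt ℝ 2 J y' := contDiffAt_chartMap hj x
  set D := fderiv ℝ (chartMetric g (j x)) y with hD
  have hincl : ∀ a : E', (incl (E := E) j x : E' →L[ℝ] E) a = fderiv ℝ J y' a :=
    incl_eq_fderiv_chartMap hj x
  set a := fderiv ℝ J y' u with ha
  set b := fderiv ℝ J y' v with hb
  set γ := fderiv ℝ (fderiv ℝ J) y' u v with hγ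
  -- `c ↦ ⟨J''(u, v), c⟩ + Γ(J'u, J'v; c)`
  refine ⟨(chartMetric g (j x) y γ : E →ₗ[ℝ] ℝ) +
    (1 / 2 : ℝ) • ((D a b : E →ₗ[ℝ] ℝ) + (D b a : E →ₗ[ℝ] ℝ) -
      ((D.flip b).flip a : E →ₗ[ℝ] ℝ)), fun f hf => ?_⟩
  have hL : ∀ c : E, ((chartMetric g (j x) y γ : E →ₗ[ℝ] ℝ) +
    (1 / 2 : ℝ) • ((D a b : E →ₗ[ℝ] ℝ) + (D b a : E →ₗ[ℝ] ℝ) -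
      ((D.flip b).flip a : E →ₗ[ℝ] ℝ))) c =
      chartMetric g (j x) y γ c + christoffelForm D a b c := by
    intro c
    simp [christoffelForm]
  have hg' := hg.inducedMetric hj hinj
  have hfj : ContMDiff 𝓘(ℝ, E') 𝓘(ℝ, ℝ) ∞ (f ∘ j) := hf.comp hj
  set X : E := grad g f (j x) with hX
  set X' : E' := grad (RiemHess.inducedMetric E' g j) (f ∘ j) x with hX'
  have hsymm : ∀ b c, chartMetric g (j x) y b c = chartMetric g (j x) y c b :=
    fun b c => hg.symm _ (chartInvDeriv (j x) y b) (chartInvDeriv (j x) y c)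
  have e1 : (f ∘ j) ∘ (extChartAt 𝓘(ℝ, E') x).symm =ᶠ[nhds y']
      (f ∘ (extChartAt 𝓘(ℝ, E) (j x)).symm) ∘ J := by
    filter_upwards [extChartAt_symm_comp_chartMap hj x] with z hz
    exact congrArg f hz.symm
  have e2 := fderiv_fderiv_comp (J := J) (y := y')
    (by rw [hJy]; exact contDiffAt_comp_extChartAt_symm hf (j x)) hJ u v
  have e3 := christoffelForm_pullback (h := chartMetric g (j x)) (J := J) (y := y')
    (by rw [hJy]; exact hsymm) (by rw [hJy]; exact hg.differentiableAt) hJ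
    (chartMetric_inducedMetric hj g x) u v X'
  have e4 : fderiv ℝ (f ∘ (extChartAt 𝓘(ℝ, E) (j x)).symm) y γ = chartMetric g (j x) y γ X := by
    have hyt := mem_extChartAt_target (I := 𝓘(ℝ, E)) (j x)
    have h := hg.chartField_grad hf hyt
    rw [chartField_self] at h
    obtain ⟨e, he⟩ := hg.isInvertible_chartMetric hyt
    rw [hsymm γ X, hX, h, hy, ← he]
    simp
  have e5 : (restrictForm j x (hess g f (j x)) : E' →L[ℝ] E' →L[ℝ] ℝ) u v =
      fderiv ℝ (fderiv ℝ (f ∘ (extChartAt 𝓘(ℝ, E) (j x)).symm)) y a b - christoffelForm D a b X :=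
    calc (restrictForm j x (hess g f (j x)) : E' →L[ℝ] E' →L[ℝ] ℝ) u v
        = (hess g f (j x) : E →L[ℝ] E →L[ℝ] ℝ) ((incl (E := E) j x : E' →L[ℝ] E) u)
            ((incl (E := E) j x : E' →L[ℝ] E) v) := rfl
      _ = (hess g f (j x) : E →L[ℝ] E →L[ℝ] ℝ) a b := by rw [hincl, hincl]
      _ = _ := hg.hess_apply hf a b
  have e6 : (hess (RiemHess.inducedMetric E' g j) (f ∘ j) x : E' →L[ℝ] E' →L[ℝ] ℝ) u v =
      fderiv ℝ (fderiv ℝ ((f ∘ j) ∘ (extChartAt 𝓘(ℝ, E') x).symm)) y' u v -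
        christoffelForm (fderiv ℝ (chartMetric (RiemHess.inducedMetric E' g j) x) y') u v X' :=
    hg'.hess_apply hfj u v
  rw [e6, e5, e1.fderiv.fderiv_eq, e2, e3, hJy, hincl, ← hγ, e4, hL, hL]
  ring

end Pullback

/-! ### The tangent space of a regular level set -/

section LevelSet

variable {j : S → M}

omit [IsManifold 𝓘(ℝ, E) ∞ M] [IsManifold 𝓘(ℝ, E') ∞ S] in
/-- An immersion has a local left inverse: the projection in charts where it is a linear
inclusion. -/
theorem exists_local_leftInverse {x : S}
    (h : Manifold.IsImmersionAt 𝓘(ℝ, E') 𝓘(ℝ, E) ∞ j x) :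
    ∃ r : M → S, MDifferentiableAt 𝓘(ℝ, E) 𝓘(ℝ, E') r (j x) ∧ ∀ᶠ s in nhds x, r (j s) = s := by
  have key : ∀ s ∈ h.domChart.source, (h.equiv.symm (h.codChart (j s))).1 = h.domChart s := by
    intro s hs
    have h1 := h.writtenInCharts (show h.domChart s ∈ (h.domChart.extend 𝓘(ℝ, E')).target by
      simpa using h.domChart.map_source hs)
    simp only [mfld_simps, hs] at h1
    rw [h1]
    simp
  refine ⟨fun q => h.domChart.symm (h.equiv.symm (h.codChart q)).1, ?_, ?_⟩
  · have hcod : ContMDiffAt 𝓘(ℝ, E) 𝓘(ℝ, E) ∞ h.codChart (j x) :=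
      contMDiffAt_of_mem_maximalAtlas h.codChart_mem_maximalAtlas h.mem_codChart_source
    have hlin : ContMDiffAt 𝓘(ℝ, E) 𝓘(ℝ, E') ∞ (fun q => (h.equiv.symm (h.codChart q)).1) (j x) :=
      ((ContinuousLinearMap.fst ℝ E' h.complement).comp
        (h.equiv.symm : E →L[ℝ] E' × h.complement)).contMDiff.contMDiffAt.comp _ hcod
    have hdom : ContMDiffAt 𝓘(ℝ, E') 𝓘(ℝ, E') ∞ h.domChart.symm
        (h.equiv.symm (h.codChart (j x))).1 := by
      rw [key x h.mem_domChart_source]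
      exact contMDiffAt_symm_of_mem_maximalAtlas h.domChart_mem_maximalAtlas
        (h.domChart.map_source h.mem_domChart_source)
    exact (ContMDiffAt.comp (j x) hdom hlin).mdifferentiableAt (by simp)
  · filter_upwards [h.domChart.open_source.mem_nhds h.mem_domChart_source] with s hs
    rw [key s hs]
    exact h.domChart.left_inv hs

omit [IsManifold 𝓘(ℝ, E) ∞ M] [IsManifold 𝓘(ℝ, E') ∞ S] in
theorem incl_congr {q x : S} (h : q = x) (a : E') :
    (incl (E := E) j q : E' →L[ℝ] E) a = (incl (E := E) j x : E' →L[ℝ] E) a := by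
  subst h; rfl

omit [IsManifold 𝓘(ℝ, E) ∞ M] [IsManifold 𝓘(ℝ, E') ∞ S] in
theorem injective_incl {x : S} (hj : MDifferentiableAt 𝓘(ℝ, E') 𝓘(ℝ, E) j x)
    (h : Manifold.IsImmersionAt 𝓘(ℝ, E') 𝓘(ℝ, E) ∞ j x) :
    Function.Injective (incl (E := E) (E' := E') j x) := by
  obtain ⟨r, hr, he⟩ := exists_local_leftInverse h
  have h1 := mfderiv_comp x hr hj
  have h2 : r ∘ j =ᶠ[nhds x] id := he
  have h3 := h2.mfderiv_eq (I := 𝓘(ℝ, E')) (I' := 𝓘(ℝ, E'))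
  rw [mfderiv_id] at h3
  have h4 : ∀ u : E', (mfderiv 𝓘(ℝ, E) 𝓘(ℝ, E') r (j x) : E →L[ℝ] E')
      ((incl (E := E) j x : E' →L[ℝ] E) u) = u := fun u =>
    (DFunLike.congr_fun h1 u).symm.trans (DFunLike.congr_fun h3 u)
  exact Function.LeftInverse.injective h4

omit [IsManifold 𝓘(ℝ, E') ∞ S] in
/-- The tangent space of a regular level set contains the kernel of the differential: a vector in
the kernel is the velocity of the level set parametrized by the implicit function theorem, and this
parametrization factors through `j` because `j` is an embedding. -/
theorem exists_incl_eq [FiniteDimensional ℝ E] {k : ℕ} {F : M → EuclideanSpace ℝ (Fin k)}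
    (hF : ContMDiff 𝓘(ℝ, E) 𝓘(ℝ, EuclideanSpace ℝ (Fin k)) ∞ F)
    {c : EuclideanSpace ℝ (Fin k)} (hc : IsRegularValue E F c)
    (hj : Manifold.IsSmoothEmbedding 𝓘(ℝ, E') 𝓘(ℝ, E) ∞ j) (hS : Set.range j = F ⁻¹' {c})
    (x : S) (v : E)
    (hv : (mfderiv 𝓘(ℝ, E) 𝓘(ℝ, EuclideanSpace ℝ (Fin k)) F (j x) :
      E →L[ℝ] EuclideanSpace ℝ (Fin k)) v = 0) :
    ∃ u : E', (incl (E := E) j x : E' →L[ℝ] E) u = v := by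
  have hcomplete : CompleteSpace E := FiniteDimensional.complete ℝ E
  obtain ⟨r, hr, he⟩ := exists_local_leftInverse (hj.isImmersion.isImmersionAt x)
  have hFj : F (j x) = c := by
    have : j x ∈ F ⁻¹' {c} := hS ▸ Set.mem_range_self x
    exact this
  set φ := extChartAt 𝓘(ℝ, E) (j x) with hφ
  set y := φ (j x) with hy
  have hφy : φ.symm y = j x := extChartAt_to_inv (I := 𝓘(ℝ, E)) (j x)
  have hA : ∀ a : E, (chartInvDeriv (j x) y : E →L[ℝ] E) a = a := fun a => by
    rw [hy, hφ, chartInvDeriv_self]; rfl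
  set f : E → EuclideanSpace ℝ (Fin k) := F ∘ φ.symm with hf
  have hfy : f y = c := by rw [hf, Function.comp_apply, hφy, hFj]
  have hfd : ContDiffAt ℝ ∞ f y := contMDiffAt_iff_contDiffAt.1
    ((hF _).comp _ (contMDiffAt_extChartAt_symm_self (E := E) (j x)))
  have hstrict : HasStrictFDerivAt f (fderiv ℝ f y) y := hfd.hasStrictFDerivAt (by simp)
  have hderiv : ∀ a : E, fderiv ℝ f y a = (mfderiv 𝓘(ℝ, E) 𝓘(ℝ, EuclideanSpace ℝ (Fin k)) F (j x) :
      E →L[ℝ] EuclideanSpace ℝ (Fin k)) a := by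
    intro a
    have h := mfderiv_comp y ((hF _).mdifferentiableAt (by simp))
      (mdifferentiableAt_extChartAt_symm (mem_extChartAt_target (I := 𝓘(ℝ, E)) (j x)))
    rw [mfderiv_eq_fderiv] at h
    have h2 : ∀ q, q = j x → ∀ b : E, (mfderiv 𝓘(ℝ, E) 𝓘(ℝ, EuclideanSpace ℝ (Fin k)) F q :
      E →L[ℝ] EuclideanSpace ℝ (Fin k)) b =
      (mfderiv 𝓘(ℝ, E) 𝓘(ℝ, EuclideanSpace ℝ (Fin k)) F (j x) :
      E →L[ℝ] EuclideanSpace ℝ (Fin k)) b := by rintro q rfl b; rfl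
    exact (DFunLike.congr_fun h a).trans ((h2 _ hφy _).trans
      (congrArg (mfderiv 𝓘(ℝ, E) 𝓘(ℝ, EuclideanSpace ℝ (Fin k)) F (j x) :
        E →L[ℝ] EuclideanSpace ℝ (Fin k)) (hA a)))
  have hsurj : (fderiv ℝ f y).range = ⊤ := LinearMap.range_eq_top.2 fun w => by
    obtain ⟨a, ha⟩ := hc (j x) hFj w
    exact ⟨a, (hderiv a).trans ha⟩
  -- `γ` parametrizes the level set in the chart, with velocity `v` in the direction `v` at `0`.
  set γ : (fderiv ℝ f y).ker → E := hstrict.implicitFunction f (fderiv ℝ f y) hsurj (f y) with hγ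
  have hγ0 : γ 0 = y := hstrict.implicitFunction_apply_image hsurj
  have hγd : HasFDerivAt γ (fderiv ℝ f y).ker.subtypeL 0 :=
    (hstrict.to_implicitFunction hsurj).hasFDerivAt
  have hfγ : ∀ᶠ t in nhds (0 : (fderiv ℝ f y).ker), f (γ t) = f y := by
    have h := hstrict.map_implicitFunction_eq hsurj
    have hcont : Filter.Tendsto (fun t : (fderiv ℝ f y).ker => (f y, t)) (nhds 0)
        (nhds (f y, 0)) := (Continuous.prodMk_right (f y)).tendsto 0
    exact hcont.eventually h
  have hφd : MDifferentiableAt 𝓘(ℝ, E) 𝓘(ℝ, E) φ.symm (γ 0) := by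
    rw [hγ0]
    exact mdifferentiableAt_extChartAt_symm (mem_extChartAt_target (I := 𝓘(ℝ, E)) (j x))
  set α : (fderiv ℝ f y).ker → M := φ.symm ∘ γ with hα
  have hα0 : α 0 = j x := by rw [hα, Function.comp_apply, hγ0, hφy]
  have hαd : MDifferentiableAt 𝓘(ℝ, (fderiv ℝ f y).ker) 𝓘(ℝ, E) α 0 :=
    hφd.comp 0 hγd.differentiableAt.mdifferentiableAt
  have hlim : Filter.Tendsto α (nhds 0) (nhdsWithin (j x) (Set.range j)) := by
    refine tendsto_nhdsWithin_iff.2 ⟨?_, ?_⟩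
    · have := hαd.continuousAt
      rwa [ContinuousAt, hα0] at this
    · filter_upwards [hfγ] with t ht
      rw [hS]
      exact ht.trans hfy
  -- The topology of `S` is induced by `j`, so points of the level set near `j x` come from points
  -- near `x`, where `r` inverts `j`.
  have hjr : ∀ᶠ q in nhdsWithin (j x) (Set.range j), j (r q) = q := by
    rw [← hj.isEmbedding.map_nhds_eq x, Filter.eventually_map]
    exact he.mono fun s hs => congrArg j hs
  have hfac : j ∘ (r ∘ α) =ᶠ[nhds 0] α := hlim.eventually hjr
  have hrα0 : (r ∘ α) 0 = x := by rw [Function.comp_apply, hα0]; exact he.self_of_nhds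
  have hrαd : MDifferentiableAt 𝓘(ℝ, (fderiv ℝ f y).ker) 𝓘(ℝ, E') (r ∘ α) 0 :=
    MDifferentiableAt.comp 0 (by rw [hα0]; exact hr) hαd
  have k1 := mfderiv_comp 0 ((hj.contMDiff ((r ∘ α) 0)).mdifferentiableAt (by simp)) hrαd
  have k2 := hfac.mfderiv_eq (I := 𝓘(ℝ, (fderiv ℝ f y).ker)) (I' := 𝓘(ℝ, E))
  have k3 := mfderiv_comp 0 hφd hγd.differentiableAt.mdifferentiableAt
  have hker : v ∈ (fderiv ℝ f y).ker := (hderiv v).trans hv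
  let w : (fderiv ℝ f y).ker := ⟨v, hker⟩
  have k4 : (mfderiv 𝓘(ℝ, (fderiv ℝ f y).ker) 𝓘(ℝ, E) α 0 : (fderiv ℝ f y).ker →L[ℝ] E) w = v := by
    have hA' : ∀ z, z = y → (chartInvDeriv (j x) z : E →L[ℝ] E) v = v := by
      rintro z rfl; exact hA v
    rw [mfderiv_eq_fderiv, hγd.fderiv] at k3
    exact (DFunLike.congr_fun k3 w).trans (hA' _ hγ0)
  refine ⟨(mfderiv 𝓘(ℝ, (fderiv ℝ f y).ker) 𝓘(ℝ, E') (r ∘ α) 0 :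
    (fderiv ℝ f y).ker →L[ℝ] E') w, ?_⟩
  exact (incl_congr hrα0 _).symm.trans
    ((DFunLike.congr_fun k1 w).symm.trans ((DFunLike.congr_fun k2 w).trans k4))

end LevelSet

/-! ### Symmetry of the Hessian, and differentials of components -/

section Hessian

variable [FiniteDimensional ℝ E]

theorem IsMetricAt.hess_symm {g : FormField E M} {p : M} (hg : IsMetricAt g p) {f : M → ℝ}
    (hf : ContMDiff 𝓘(ℝ, E) 𝓘(ℝ, ℝ) ∞ f) (u v : TangentSpace 𝓘(ℝ, E) p) :
    hess g f p u v = hess g f p v u := by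
  have hD := fderiv_symm_of_eventually (h := chartMetric g p) (y := extChartAt 𝓘(ℝ, E) p p)
    (Filter.Eventually.of_forall fun z b c => hg.symm _ (chartInvDeriv p z b) (chartInvDeriv p z c))
    hg.differentiableAt
  have h2 := ((contDiffAt_comp_extChartAt_symm hf p).isSymmSndFDerivAt (by simp)) u v
  have hc : ∀ a b c : E,
      christoffelForm (fderiv ℝ (chartMetric g p) (extChartAt 𝓘(ℝ, E) p p)) a b c =
      christoffelForm (fderiv ℝ (chartMetric g p) (extChartAt 𝓘(ℝ, E) p p)) b a c := by
    intro a b c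
    rw [christoffelForm, christoffelForm, hD c b a]
    ring
  exact (hg.hess_apply hf u v).trans
    ((congrArg₂ (· - ·) h2 (hc u v _)).trans (hg.hess_apply hf v u).symm)

omit [IsManifold 𝓘(ℝ, E) ∞ M] [FiniteDimensional ℝ E] in
theorem grad_eq_zero {g : FormField E M} {f : M → ℝ} {p : M} (h : dform (E := E) f p = 0) :
    grad g f p = 0 := by
  rw [grad, h, map_zero]

omit [IsManifold 𝓘(ℝ, E) ∞ M] [FiniteDimensional ℝ E] in
theorem dform_const (a : ℝ) (p : M) : dform (E := E) (fun _ : M => a) p = 0 :=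
  mfderiv_const

theorem IsMetricAt.hess_const {g : FormField E M} {p : M} (hg : IsMetricAt g p) (a : ℝ) (u v : E) :
    (hess g (fun _ : M => a) p : E →L[ℝ] E →L[ℝ] ℝ) u v = 0 := by
  have h : @Eq E (grad g (fun _ : M => a) p) 0 := grad_eq_zero (dform_const a p)
  have h0 : (fun _ : M => a) ∘ (extChartAt 𝓘(ℝ, E) p).symm = fun _ => a := rfl
  have h1 : fderiv ℝ (fun _ : E => a) = fun _ => 0 := by ext; simp
  rw [hg.hess_apply contMDiff_const, h, h0, h1, christoffelForm_zero_right]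
  simp

end Hessian

section Differential

variable {j : S → M}

omit [IsManifold 𝓘(ℝ, E) ∞ M] [IsManifold 𝓘(ℝ, E') ∞ S] in
theorem dform_comp {f : M → ℝ} (hf : ContMDiff 𝓘(ℝ, E) 𝓘(ℝ, ℝ) ∞ f)
    (hj : ContMDiff 𝓘(ℝ, E') 𝓘(ℝ, E) ∞ j) (x : S) (u : TangentSpace 𝓘(ℝ, E') x) :
    dform (E := E') (f ∘ j) x u = dform f (j x) (incl (E := E) j x u) :=
  DFunLike.congr_fun (mfderiv_comp x ((hf _).mdifferentiableAt (by simp))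
    ((hj _).mdifferentiableAt (by simp))) u

variable {k : ℕ} {F : M → EuclideanSpace ℝ (Fin k)}

omit [IsManifold 𝓘(ℝ, E) ∞ M] in
theorem contMDiff_comps (hF : ContMDiff 𝓘(ℝ, E) 𝓘(ℝ, EuclideanSpace ℝ (Fin k)) ∞ F) (i : Fin k) :
    ContMDiff 𝓘(ℝ, E) 𝓘(ℝ, ℝ) ∞ (comps F i) :=
  (ContinuousLinearMap.contMDiff
    (EuclideanSpace.proj (𝕜 := ℝ) i : EuclideanSpace ℝ (Fin k) →L[ℝ] ℝ)).comp hF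

omit [IsManifold 𝓘(ℝ, E) ∞ M] in
theorem dform_comps (hF : ContMDiff 𝓘(ℝ, E) 𝓘(ℝ, EuclideanSpace ℝ (Fin k)) ∞ F) (i : Fin k) (p : M)
    (v : TangentSpace 𝓘(ℝ, E) p) :
    dform (comps F i) p v =
      (EuclideanSpace.proj (𝕜 := ℝ) i : EuclideanSpace ℝ (Fin k) →L[ℝ] ℝ)
        (mfderiv 𝓘(ℝ, E) 𝓘(ℝ, EuclideanSpace ℝ (Fin k)) F p v) := by
  have h := mfderiv_comp p
    (g := (EuclideanSpace.proj (𝕜 := ℝ) i : EuclideanSpace ℝ (Fin k) →L[ℝ] ℝ))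
    (I' := 𝓘(ℝ, EuclideanSpace ℝ (Fin k))) (I'' := 𝓘(ℝ, ℝ))
    (ContinuousLinearMap.mdifferentiableAt _) ((hF p).mdifferentiableAt (by simp))
  rw [ContinuousLinearMap.mfderiv_eq] at h
  exact DFunLike.congr_fun h v

variable [FiniteDimensional ℝ E]

omit [IsManifold 𝓘(ℝ, E) ∞ M] in
theorem linearIndependent_grad {g : FormField E M} {p : M} (hg : IsMetricAt g p)
    (hF : ContMDiff 𝓘(ℝ, E) 𝓘(ℝ, EuclideanSpace ℝ (Fin k)) ∞ F)
    (hp : Function.Surjective (mfderiv 𝓘(ℝ, E) 𝓘(ℝ, EuclideanSpace ℝ (Fin k)) F p)) :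
    LinearIndependent ℝ fun i => grad g (comps F i) p := by
  rw [Fintype.linearIndependent_iff]
  intro l hl i
  obtain ⟨w, hw⟩ := hp (EuclideanSpace.single i (1 : ℝ))
  have h := congrArg (fun n => g p n w) hl
  simp only [map_sum, map_smul, map_zero, sum_apply, smul_apply,
    zero_apply, hg.apply_grad, dform_comps hF, smul_eq_mul] at h
  rw [Finset.sum_eq_single i] at h
  · simpa [hw] using h
  · intro b _ hb
    rw [hw]
    simp [hb]
  · simp

end Differential

end RiemHess

/-! ### Hessians and Lagrange multipliers on level sets -/

theorem theorem2p1
    {E : Type*} [NormedAddCommGroup E] [NormedSpace ℝ E] [FiniteDimensional ℝ E]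
    {M : Type*} [TopologicalSpace M] [ChartedSpace E M] [IsManifold 𝓘(ℝ, E) ∞ M]
    (g : Bundle.ContMDiffRiemannianMetric 𝓘(ℝ, E) ∞ E (fun x : M => TangentSpace 𝓘(ℝ, E) x))
    {k : ℕ} (F : M → EuclideanSpace ℝ (Fin k))
    (hF : ContMDiff 𝓘(ℝ, E) 𝓘(ℝ, EuclideanSpace ℝ (Fin k)) ∞ F)
    (c : EuclideanSpace ℝ (Fin k)) (hc : RiemHess.IsRegularValue E F c)
    {E' : Type*} [NormedAddCommGroup E'] [NormedSpace ℝ E'] [FiniteDimensional ℝ E']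
    {S : Type*} [TopologicalSpace S] [ChartedSpace E' S] [IsManifold 𝓘(ℝ, E') ∞ S]
    (j : S → M) (hj : Manifold.IsSmoothEmbedding 𝓘(ℝ, E') 𝓘(ℝ, E) ∞ j)
    (hS : Set.range j = F ⁻¹' {c})
    (GS : S → ℝ) (hGS : ContMDiff 𝓘(ℝ, E') 𝓘(ℝ, ℝ) ∞ GS)
    (G : M → ℝ) (hG : ContMDiff 𝓘(ℝ, E) 𝓘(ℝ, ℝ) ∞ G) (hext : ∀ x : S, G (j x) = GS x)
    (x : S) :
    (RiemHess.gram g.inner (RiemHess.comps F) (RiemHess.comps F) (j x)).det ≠ 0 ∧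
    (∀ u v : TangentSpace 𝓘(ℝ, E') x,
      RiemHess.hess (RiemHess.inducedMetric E' g.inner j) GS x u v =
        RiemHess.hess (RiemHess.inducedMetric E' g.inner j) GS x v u) ∧
    RiemHess.hess (RiemHess.inducedMetric E' g.inner j) GS x =
      RiemHess.restrictForm j x (RiemHess.hess g.inner G (j x)) -
        ∑ i : Fin k, RiemHess.sigma g.inner (RiemHess.comps F) G i (j x) •
          RiemHess.restrictForm j x (RiemHess.hess g.inner (RiemHess.comps F i) (j x)) ∧
    (RiemHess.dform (E := E') GS x = 0 →
      ∀ l : Fin k → ℝ,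
        RiemHess.grad g.inner G (j x) =
            ∑ i : Fin k, l i • RiemHess.grad g.inner (RiemHess.comps F i) (j x) ↔
          ∀ i : Fin k, l i = RiemHess.sigma g.inner (RiemHess.comps F) G i (j x)) := by
  have hjs : ContMDiff 𝓘(ℝ, E') 𝓘(ℝ, E) ∞ j := hj.contMDiff
  have hinj : ∀ s, Function.Injective (RiemHess.incl (E := E) (E' := E') j s) := fun s =>
    RiemHess.injective_incl ((hjs s).mdifferentiableAt (by simp)) (hj.isImmersion.isImmersionAt s)
  have hg := RiemHess.isMetricAt_riemannianMetric g (j x)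
  have hg' := hg.inducedMetric hjs hinj
  have hmem : ∀ s, F (j s) = c := fun s => by
    have h : j s ∈ F ⁻¹' {c} := hS ▸ Set.mem_range_self s
    exact h
  obtain rfl : GS = G ∘ j := funext fun s => (hext s).symm
  let B : TangentSpace 𝓘(ℝ, E) (j x) →ₗ[ℝ] TangentSpace 𝓘(ℝ, E) (j x) →ₗ[ℝ] ℝ :=
    (g.inner (j x)).toLinearMap₁₂
  let n : Fin k → TangentSpace 𝓘(ℝ, E) (j x) :=
    fun i => RiemHess.grad g.inner (RiemHess.comps F i) (j x)
  let w : TangentSpace 𝓘(ℝ, E) (j x) := RiemHess.grad g.inner G (j x)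
  let X' : TangentSpace 𝓘(ℝ, E') x :=
    RiemHess.grad (RiemHess.inducedMetric E' g.inner j) (G ∘ j) x
  let σ : Fin k → ℝ := fun i => RiemHess.sigma g.inner (RiemHess.comps F) G i (j x)
  have hB : ∀ v w, B v w = g.inner (j x) v w := fun _ _ => rfl
  have hn : LinearIndependent ℝ n := RiemHess.linearIndependent_grad hg hF (hc (j x) (hmem x))
  have hdet : (Matrix.of fun i j => B (n j) (n i)).det ≠ 0 :=
    RiemHess.det_gram_ne_zero B (hg.pos (j x)) hn
  -- Replacing `F_i` by `G` among the column functions changes only the `i`-th column of the Gram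
  -- matrix, as in Cramer's rule.
  have hσ : ∀ i, σ i = ((Matrix.of fun i j => B (n j) (n i)).updateCol i fun r => B w (n r)).det /
      (Matrix.of fun i j => B (n j) (n i)).det := fun i => by
    have : RiemHess.gram g.inner (RiemHess.comps F) (Function.update (RiemHess.comps F) i G) (j x) =
        (Matrix.of fun i j => B (n j) (n i)).updateCol i fun r => B w (n r) := by
      ext r s
      by_cases hs : s = i
      · subst hs
        rw [Matrix.updateCol_self]
        simp only [RiemHess.gram, Matrix.of_apply, Function.update_self]
        rfl
      · rw [Matrix.updateCol_ne hs]
        simp only [RiemHess.gram, Matrix.of_apply, Function.update_of_ne hs]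
        rfl
    change Matrix.det _ / Matrix.det _ = _
    rw [this]
    rfl
  have hBn : ∀ i v, B (n i) v = RiemHess.dform (RiemHess.comps F i) (j x) v := fun i v => by
    rw [hB, hg.apply_grad]
  have hcomp : ∀ i, RiemHess.comps F i ∘ j = fun _ => c i := fun i =>
    funext fun s => by simp only [Function.comp_apply, RiemHess.comps, hmem]
  have hBtan : ∀ i u, B (n i) (RiemHess.incl j x u) = 0 := fun i u => by
    rw [hBn, ← RiemHess.dform_comp (RiemHess.contMDiff_comps hF i) hjs, hcomp,
      RiemHess.dform_const]
    rfl
  have hsymm : ∀ v w, B v w = B w v := hg.symm (j x)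
  -- The normal part of `grad G` is `∑ σ_i grad F_i`.
  have hN : w - RiemHess.incl j x X' = ∑ i, σ i • n i := by
    set R := w - RiemHess.incl j x X' - ∑ i, σ i • n i with hR
    have hRn : ∀ r, B R (n r) = 0 := fun r => by
      have h := RiemHess.apply_sub_cramer_eq_zero B hdet w r
      simp only [← hσ] at h
      rw [hR, sub_right_comm, map_sub, LinearMap.sub_apply, h, hsymm, hBtan, sub_zero]
    have hker : mfderiv 𝓘(ℝ, E) 𝓘(ℝ, EuclideanSpace ℝ (Fin k)) F (j x) R = 0 := by
      refine PiLp.ext fun i => ?_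
      have h := hRn i
      rw [hsymm, hBn, RiemHess.dform_comps hF] at h
      exact h
    obtain ⟨d, hd⟩ : ∃ d : TangentSpace 𝓘(ℝ, E') x, RiemHess.incl (E := E) j x d = R :=
      RiemHess.exists_incl_eq hF hc hj hS x R hker
    have hwd : B (w - RiemHess.incl j x X') (RiemHess.incl j x d) = 0 := by
      have h1 : B w (RiemHess.incl j x d) =
          RiemHess.dform G (j x) (RiemHess.incl (E := E) j x d) := by
        rw [hB, hg.apply_grad]
      have h2 : B (RiemHess.incl j x X') (RiemHess.incl j x d) =
          RiemHess.dform (E := E') (G ∘ j) x d := by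
        rw [← hg'.apply_grad]
        rfl
      rw [map_sub, LinearMap.sub_apply, h1, h2, RiemHess.dform_comp hG hjs, sub_self]
    -- `R` is tangent to `S` because it is orthogonal to the `grad F_i`, and it is also normal.
    have hRR : B R R = 0 := by
      calc B R R = B R (RiemHess.incl j x d) := by rw [hd]
        _ = 0 := by
          rw [hR, map_sub, LinearMap.sub_apply, hwd, map_sum, LinearMap.sum_apply, zero_sub,
            neg_eq_zero]
          refine Finset.sum_eq_zero fun i _ => ?_
          rw [map_smul, LinearMap.smul_apply, hBtan, smul_zero]
    have hR0 : R = 0 := by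
      by_contra hne
      exact (hg.pos (j x) R hne).ne' hRR
    exact sub_eq_zero.1 hR0
  refine ⟨hdet, fun u v => hg'.hess_symm hGS u v, ?_, fun hcrit l => ?_⟩
  · refine ContinuousLinearMap.ext fun u => ContinuousLinearMap.ext fun v => ?_
    obtain ⟨L, hL⟩ : ∃ L : TangentSpace 𝓘(ℝ, E) (j x) →ₗ[ℝ] ℝ, ∀ f : M → ℝ,
        ContMDiff 𝓘(ℝ, E) 𝓘(ℝ, ℝ) ∞ f →
        RiemHess.hess (RiemHess.inducedMetric E' g.inner j) (f ∘ j) x u v =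
          RiemHess.restrictForm j x (RiemHess.hess g.inner f (j x)) u v +
            (L (RiemHess.grad g.inner f (j x)) - L (RiemHess.incl j x
              (RiemHess.grad (RiemHess.inducedMetric E' g.inner j) (f ∘ j) x))) :=
      RiemHess.exists_hess_comp_eq hg hjs hinj u v
    have hLn : ∀ i, L (n i) =
        -RiemHess.restrictForm j x (RiemHess.hess g.inner (RiemHess.comps F i) (j x)) u v := by
      intro i
      have h := hL _ (RiemHess.contMDiff_comps hF i)
      have h0 : RiemHess.hess (RiemHess.inducedMetric E' g.inner j) (fun _ : S => c i) x u v = 0 :=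
        hg'.hess_const (c i) u v
      rw [hcomp, h0, RiemHess.grad_eq_zero (RiemHess.dform_const (c i) x), map_zero, map_zero,
        sub_zero] at h
      exact (neg_eq_of_add_eq_zero_right h.symm).symm
    rw [hL G hG, ← map_sub]
    change _ + L (w - RiemHess.incl j x X') = _
    rw [hN, map_sum]
    simp only [map_smul, hLn, smul_eq_mul, mul_neg, Finset.sum_neg_distrib, sub_apply, sum_apply,
      smul_apply, ← sub_eq_add_neg]
    rfl
  · have hX' : X' = 0 := RiemHess.grad_eq_zero hcrit
    rw [hX', map_zero, sub_zero] at hN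
    change w = ∑ i, l i • n i ↔ ∀ i, l i = σ i
    rw [hN]
    refine ⟨fun h i => ?_, fun h => by simp only [h]⟩
    have h0 : ∑ i, (l i - σ i) • n i = 0 := by
      simp only [sub_smul, Finset.sum_sub_distrib, h, sub_self]
    exact sub_eq_zero.1 (Fintype.linearIndependent_iff.1 hn _ h0 i)
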